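/- There is an absolute constant $C>0$ such that the following holds. Let $n,d,k\ge 0$ be integers, let $X=(X_1,\dots,X_n)$ be a random vector with values in $\{0,1\}^n$, let $A_1,\dots,A_n$ be symmetric $d\times d$ real matrices, and let $D\in\mathbb{R}$. Assume that (a) $X$ is $k$-homogeneous, i.e. $\sum_{i=1}^n X_i=k$ with probability one; (b) $X$ is one-sided $\ell_\infty$-independent with parameter $D$, i.e. for every $\Lambda\subseteq\{1,\dots,n\}$ the $n\times n$ matrix $\mathcal{I}^\Lambda$ with entries $$\mathcal{I}^\Lambda(i,j)=\mathbb{P}(X_j=1\mid X_i=1,\ \forall_{\ell\in\Lambda}\,X_\ell=1)-\mathbb{P}(X_j=1\mid \forall_{\ell\in\Lambda}\,X_\ell=1)$$ if $\mathbb{P}(X_i=1,\ \forall_{\ell\in\Lambda}\,X_\ell=1)>0$, and $\mathcal{I}^\Lambda(i,j)=0$ otherwise, satisfies $$\|\mathcal{I}^\Lambda\|_{\ell_\infty\to\ell_\infty}=\max_{i\le n}\sum_{j=1}^n|\mathcal{I}^\Lambda(i,j)|\le D .$$ Put $Z=\sum_{i=1}^n X_iA_i$, $\sigma^2=\big\|\mathbb{E}\sum_{i=1}^n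 X_iA_i^2\big\|$ and $R=\max_{i\le n}\|A_i\|$, where $\|\cdot\|$ is the operator norm of a matrix on Euclidean space $\mathbb{R}^d$ (maxima over the empty set being $0$). Then for all $t>0$, $$\mathbb{P}\big(\|Z-\mathbb{E}Z\|\ge t\big)\le 2d\exp\Big(-\frac{1}{CD^2}\min\Big(\frac{t^2}{\sigma^2},\frac{t}{R}\Big)\Big),$$ where, if $\sigma^2$, $R$ or $D$ vanishes, the exponent is read with the conventions $a/0=\infty$ for $a>0$ and $\exp(-\infty)=0$. -/

import Mathlib

open MeasureTheory ProbabilityTheory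
open scoped ENNReal

/-- The event that all coordinates with index in `Λ` are equal to one. -/
def allOnes {n : ℕ} (Λ : Finset (Fin n)) : Set (Fin n → Fin 2) :=
  {x | ∀ l ∈ Λ, x l = 1}

/-- The event that the coordinate with index `i` is equal to one. -/
def coordOne {n : ℕ} (i : Fin n) : Set (Fin n → Fin 2) :=
  {x | x i = 1}

open scoped Classical in
/-- The influence matrix of a measure on the cube, given that the coordinates in `Λ` are one:
its `(i, j)` entry is `P(X_j = 1 | X_i = 1, X_Λ = 1) - P(X_j = 1 | X_Λ = 1)` if the event
`{X_i = 1, X_Λ = 1}` has positive probability, and `0` otherwise. -/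
noncomputable def influenceMatrix {n : ℕ} (μ : Measure (Fin n → Fin 2)) (Λ : Finset (Fin n)) :
    Matrix (Fin n) (Fin n) ℝ :=
  Matrix.of fun i j =>
    if 0 < μ (coordOne i ∩ allOnes Λ) then
      (μ[coordOne j | coordOne i ∩ allOnes Λ]).toReal - (μ[coordOne j | allOnes Λ]).toReal
    else 0

section LinftyNorm

open scoped Matrix.Norms.Operator

/-- The operator norm of a matrix acting on `ℓ_∞^n`, that is, the maximal `ℓ_1` norm of a row. -/
noncomputable def linftyOpNorm {n : ℕ} (M : Matrix (Fin n) (Fin n) ℝ) : ℝ := ‖M‖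

end LinftyNorm

/-- One-sided `ℓ_∞`-independence with parameter `D` of a probability measure on the cube. -/
def OneSidedLinftyIndependent {n : ℕ} (μ : Measure (Fin n → Fin 2)) (D : ℝ) : Prop :=
  ∀ Λ : Finset (Fin n), linftyOpNorm (influenceMatrix μ Λ) ≤ D

/-- A random vector with values in the cube is `k`-homogeneous if almost surely exactly `k` of its
coordinates are equal to one. -/
def Homogeneous {Ω : Type*} [MeasurableSpace Ω] (P : Measure Ω) {n : ℕ}
    (X : Ω → Fin n → Fin 2) (k : ℕ) : Prop :=
  ∀ᵐ ω ∂P, ∑ i, (X ω i : ℕ) = k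

/-- The random matrix `∑ i, X_i A_i`. -/
noncomputable def matrixSum {Ω : Type*} {n d : ℕ} (X : Ω → Fin n → Fin 2)
    (A : Fin n → Matrix (Fin d) (Fin d) ℝ) (ω : Ω) : Matrix (Fin d) (Fin d) ℝ :=
  ∑ i, ((X ω i : ℕ) : ℝ) • A i

/- From here on, the norm of a matrix is its operator norm on Euclidean space. -/
open scoped Matrix.Norms.L2Operator

/-! The ones of X are revealed one at a time. Given that all coordinates in Λ are one, let M_Λ be
the conditional mean of Z and W_Λ that of ∑_{i ∉ Λ} X_i A_i². The potential is tr exp(H + θ M_Λ + K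
W_Λ) with H = -θ 𝔼Z. At Λ = ∅ it is tr exp(K W_∅), where ‖W_∅‖ = σ²; once |Λ| = k it is tr exp(θ (Z
- 𝔼Z)). With K = 6θ²D² and |θ| D² R small it is a supermartingale when the next index i ∉ Λ is drawn
with probability proportional to q_i = P(X_i = 1, X_Λ = 1) (`onesSum_exp_le`). This bounds the
matrix Laplace transform, and Markov's inequality finishes.

For the supermartingale step, write I for the influence matrix. Adding i changes the exponent by Y_i
= θ ∑_j I(i,j) A_j + K (∑_j I(i,j) A_j² - A_i²). Golden–Thompson and exp Y ≤ 1 + Y + Y² reduce the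
step to ∑ q_i (Y_i + Y_i²) ≤ 0. By homogeneity the influence terms average to zero, leaving the
drift -K ∑ q_i A_i². The symmetry q_i I(i,j) = q_j I(j,i) makes the row bound D serve for columns
too, so a Schur-type estimate bounds ∑ q_i Y_i² by the drift (`sum_mul_norm_increment_sq_le`).

The term A_i² in Y_i carries no factor D and is absorbed only when D is bounded below. If D < 1/2,
the law is a point mass and there is nothing to prove (`eq_of_condMass_sub_lt_half`). -/

open scoped Matrix.Norms.L2Operator

/-! ### Trace inequalities, up to Golden–Thompson -/

section TraceInequalities

open Matrix

variable {m : Type*} [Fintype m] [DecidableEq m]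

/-- A real symmetric matrix is orthogonally diagonalizable, and its operator norm is the maximal
absolute value of an eigenvalue. -/
theorem Matrix.IsHermitian.exists_diagonalization {A : Matrix m m ℝ} (hA : A.IsHermitian) :
    ∃ (U : Matrix m m ℝ) (l : m → ℝ), Uᴴ * U = 1 ∧ U * Uᴴ = 1 ∧
      A = U * diagonal l * Uᴴ ∧ ‖A‖ = ‖l‖ := by
  have h1 := Unitary.coe_star_mul_self hA.eigenvectorUnitary
  have h2 := Unitary.coe_mul_star_self hA.eigenvectorUnitary
  have h3 : A = (hA.eigenvectorUnitary : Matrix m m ℝ) * diagonal hA.eigenvalues *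
      (hA.eigenvectorUnitary : Matrix m m ℝ)ᴴ := by
    have := hA.spectral_theorem
    rw [Unitary.conjStarAlgAut_apply] at this
    exact this
  refine ⟨_, _, h1, h2, h3, ?_⟩
  rw [← l2_opNorm_diagonal]
  conv_lhs => rw [h3]
  rw [← star_eq_conjTranspose, ← Unitary.coe_star, CStarRing.norm_mul_coe_unitary,
    CStarRing.norm_coe_unitary_mul]

theorem Matrix.exp_orthogonal_conj {U : Matrix m m ℝ} (hU' : U * Uᴴ = 1)
    (l : m → ℝ) :
    NormedSpace.exp (U * diagonal l * Uᴴ) = U * diagonal (fun i => Real.exp (l i)) * Uᴴ := by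
  have hinv : U⁻¹ = Uᴴ := inv_eq_right_inv hU'
  have := Matrix.exp_conj U (diagonal l) (IsUnit.of_mul_eq_one _ hU')
  rw [hinv, Matrix.exp_diagonal] at this
  rw [this]
  congr 3
  ext i
  rw [Pi.coe_exp, Real.exp_eq_exp_ℝ]

theorem Matrix.trace_orthogonal_conj {U : Matrix m m ℝ} (hU : Uᴴ * U = 1) (l : m → ℝ) :
    (U * diagonal l * Uᴴ).trace = ∑ i, l i := by
  rw [trace_mul_comm, ← mul_assoc, hU, one_mul, trace_diagonal]

theorem Matrix.IsHermitian.trace_exp_le {A : Matrix m m ℝ} (hA : A.IsHermitian) :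
    (NormedSpace.exp A).trace ≤ Fintype.card m * Real.exp ‖A‖ := by
  obtain ⟨U, l, h1, h2, h3, h4⟩ := hA.exists_diagonalization
  rw [h4, h3, exp_orthogonal_conj h2, trace_orthogonal_conj h1]
  calc _ ≤ ∑ i : m, Real.exp ‖l‖ := Finset.sum_le_sum fun i _ =>
        Real.exp_le_exp.2 ((le_abs_self _).trans (norm_le_pi_norm l i))
    _ = _ := by simp

theorem Matrix.IsHermitian.exp_norm_le_trace_exp [Nonempty m] {A : Matrix m m ℝ}
    (hA : A.IsHermitian) (θ : ℝ) :
    Real.exp (θ * ‖A‖) ≤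
      (NormedSpace.exp (θ • A)).trace + (NormedSpace.exp ((-θ) • A)).trace := by
  obtain ⟨U, l, h1, h2, h3, h4⟩ := hA.exists_diagonalization
  have key (s : ℝ) : (NormedSpace.exp (s • A)).trace = ∑ i, Real.exp (s * l i) := by
    have : s • A = U * diagonal (fun i => s * l i) * Uᴴ := by
      rw [h3, ← smul_mul_assoc, ← mul_smul_comm]
      congr 2
      ext i j
      by_cases h : i = j <;> simp [diagonal, h]
    rw [this, exp_orthogonal_conj h2, trace_orthogonal_conj h1]
  obtain ⟨i, hi⟩ : ∃ i, ‖l i‖ = ‖l‖ := by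
    obtain ⟨i, -, hi⟩ := Finset.exists_mem_eq_sup' Finset.univ_nonempty (fun i => ‖l i‖)
    refine ⟨i, le_antisymm (norm_le_pi_norm l i) ?_⟩
    rw [← hi]
    exact (pi_norm_le_iff_of_nonempty _).2 fun j => Finset.le_sup' (fun i => ‖l i‖) (Finset.mem_univ j)
  rw [key, key, h4, ← hi, Real.norm_eq_abs]
  have hp (s : ℝ) : Real.exp (s * l i) ≤ ∑ j, Real.exp (s * l j) :=
    Finset.single_le_sum (f := fun j => Real.exp (s * l j)) (fun j _ => (Real.exp_pos _).le)
      (Finset.mem_univ i)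
  have hn (s : ℝ) : 0 ≤ ∑ j, Real.exp (s * l j) :=
    Finset.sum_nonneg fun j _ => (Real.exp_pos _).le
  rcases abs_cases (l i) with ⟨h, -⟩ | ⟨h, -⟩ <;> rw [h]
  · linarith [hp θ, hn (-θ)]
  · rw [mul_neg, ← neg_mul]
    linarith [hp (-θ), hn θ]

theorem Matrix.IsHermitian.posSemidef_exp {A : Matrix m m ℝ} (hA : A.IsHermitian) :
    (NormedSpace.exp A).PosSemidef := by
  obtain ⟨U, l, h1, h2, h3, -⟩ := hA.exists_diagonalization
  rw [h3, exp_orthogonal_conj h2]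
  exact (PosSemidef.diagonal fun i => (Real.exp_pos _).le).mul_mul_conjTranspose_same U

/-- The quadratic upper bound for the exponential of a contraction. -/
theorem Matrix.IsHermitian.posSemidef_one_add_add_sq_sub_exp {A : Matrix m m ℝ}
    (hA : A.IsHermitian) (h : ‖A‖ ≤ 1) :
    (1 + A + A * A - NormedSpace.exp A).PosSemidef := by
  obtain ⟨U, l, h1, h2, h3, h4⟩ := hA.exists_diagonalization
  have hone : (1 : Matrix m m ℝ) = U * diagonal (fun _ => 1) * Uᴴ := by
    rw [diagonal_one, mul_one, h2]
  have hsq : A * A = U * diagonal (fun i => l i * l i) * Uᴴ := by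
    rw [h3, ← diagonal_mul_diagonal]
    calc _ = U * diagonal l * (Uᴴ * U) * diagonal l * Uᴴ := by simp only [mul_assoc]
      _ = _ := by rw [h1]; simp only [mul_assoc, one_mul]
  have hexp : NormedSpace.exp A = U * diagonal (fun i => Real.exp (l i)) * Uᴴ := by
    rw [h3, exp_orthogonal_conj h2]
  have : 1 + A + A * A - NormedSpace.exp A =
      U * diagonal (fun i => 1 + l i + l i * l i - Real.exp (l i)) * Uᴴ := by
    rw [hsq, hexp, hone]
    nth_rewrite 1 [h3]
    simp only [← Matrix.add_mul, ← Matrix.mul_add, ← Matrix.sub_mul, ← Matrix.mul_sub,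
      diagonal_add, diagonal_sub]
  rw [this]
  refine (PosSemidef.diagonal fun i => ?_).mul_mul_conjTranspose_same U
  have hli : |l i| ≤ 1 := (norm_le_pi_norm l i).trans (h4 ▸ h)
  have := (abs_le.1 (Real.abs_exp_sub_one_sub_id_le hli)).2
  simp only [Pi.zero_apply]
  nlinarith

theorem Matrix.PosSemidef.trace_mul_nonneg {A B : Matrix m m ℝ} (hA : A.PosSemidef)
    (hB : B.PosSemidef) : 0 ≤ (A * B).trace := by
  obtain ⟨U, l, h1, h2, h3, -⟩ := hA.1.exists_diagonalization
  have hl (i : m) : 0 ≤ l i := by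
    have := (hA.conjTranspose_mul_mul_same U).diag_nonneg (i := i)
    have h5 : Uᴴ * A * U = diagonal l := by
      rw [h3]
      calc _ = (Uᴴ * U) * diagonal l * (Uᴴ * U) := by simp only [mul_assoc]
        _ = _ := by rw [h1, one_mul, mul_one]
    rwa [h5, diagonal_apply_eq] at this
  have h6 : (A * B).trace = ∑ i, l i * (Uᴴ * B * U) i i := by
    rw [h3, mul_assoc, trace_mul_comm, ← mul_assoc, trace_mul_comm]
    simp [trace, diagonal_mul]
  rw [h6]
  exact Finset.sum_nonneg fun i _ =>
    mul_nonneg (hl i) (hB.conjTranspose_mul_mul_same U).diag_nonneg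

/-- The Cauchy–Schwarz inequality for the trace inner product, in additive form. -/
theorem Matrix.two_mul_trace_mul_le {p : Type*} [Fintype p] (A B : Matrix p p ℝ) :
    2 * (A * B).trace ≤ (A * Aᴴ).trace + (B * Bᴴ).trace := by
  have h := (posSemidef_self_mul_conjTranspose (A - Bᴴ)).trace_nonneg
  have h1 : (Bᴴ * Aᴴ).trace = (A * B).trace := by
    rw [← conjTranspose_mul, trace_conjTranspose, star_trivial]
  have h2 : (Bᴴ * B).trace = (B * Bᴴ).trace := trace_mul_comm _ _
  rw [conjTranspose_sub, conjTranspose_conjTranspose, sub_mul, mul_sub, mul_sub, trace_sub,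
    trace_sub, trace_sub, h1, h2] at h
  linarith

theorem Matrix.trace_mul_pow_comm (A B : Matrix m m ℝ) (k : ℕ) :
    ((A * B) ^ k).trace = ((B * A) ^ k).trace := by
  cases k with
  | zero => simp
  | succ k =>
    have h : B * (A * B) ^ k = (B * A) ^ k * B :=
      SemiconjBy.pow_right (show SemiconjBy B (A * B) (B * A) from (mul_assoc B A B).symm) k
    rw [pow_succ', mul_assoc, h, trace_mul_comm, pow_succ, mul_assoc]

/-- Two trace inequalities for powers of two, proved by a simultaneous induction:
`tr (PQ)^N ≤ tr P^N Q^N` for symmetric `P`, `Q`, and `tr X^(2N) ≤ tr (X Xᵀ)^N`. -/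
theorem Matrix.trace_pow_two_pow_le (k : ℕ) :
    (∀ P Q : Matrix m m ℝ, P.IsHermitian → Q.IsHermitian →
      ((P * Q) ^ 2 ^ k).trace ≤ (P ^ 2 ^ k * Q ^ 2 ^ k).trace) ∧
    ∀ X : Matrix m m ℝ, (X ^ 2 ^ (k + 1)).trace ≤ ((X * Xᴴ) ^ 2 ^ k).trace := by
  induction k with
  | zero =>
    refine ⟨fun P Q _ _ => by simp, fun X => ?_⟩
    have h := two_mul_trace_mul_le X X
    simp only [zero_add, pow_one, pow_zero, pow_two]
    linarith
  | succ k ih =>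
    obtain ⟨ih1, ih2⟩ := ih
    refine ⟨fun P Q hP hQ => ?_, fun X => ?_⟩
    -- Here (PQ)(PQ)ᵀ = P Q² P, which under the trace of a power may be replaced by P² Q²; the first
    -- hypothesis then applies to P² and Q².
    · refine (ih2 (P * Q)).trans ?_
      have e1 : P * Q * (P * Q)ᴴ = P * (Q * Q * P) := by
        rw [conjTranspose_mul, hP.eq, hQ.eq]; simp only [mul_assoc]
      have e2 : Q * Q * P * P = (Q * Q) * (P * P) := by simp only [mul_assoc]
      rw [e1, trace_mul_pow_comm, e2, trace_mul_pow_comm]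
      have h := ih1 (P * P) (Q * Q) (hP.pow 2 |> fun h => by rwa [pow_two] at h)
        (hQ.pow 2 |> fun h => by rwa [pow_two] at h)
      rw [← pow_two, ← pow_two, ← pow_mul, ← pow_mul, ← pow_succ'] at h
      simpa only [pow_two] using h
    -- X²(X²)ᵀ is cyclically equivalent to (XXᵀ)(XᵀX). The first hypothesis separates the two
    -- factors, Cauchy–Schwarz splits them, and the two resulting traces are equal.
    · have e1 : X * X * (X * X)ᴴ = X * (X * Xᴴ * Xᴴ) := by
        rw [conjTranspose_mul]; simp only [mul_assoc]
      have e2 : X * Xᴴ * Xᴴ * X = (X * Xᴴ) * (Xᴴ * X) := by simp only [mul_assoc]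
      have hP : (Xᴴ * X).IsHermitian := isHermitian_conjTranspose_mul_self X
      have hQ : (X * Xᴴ).IsHermitian := isHermitian_mul_conjTranspose_self X
      have h := ih2 (X * X)
      rw [e1, trace_mul_pow_comm X (X * Xᴴ * Xᴴ), e2, ← pow_two, ← pow_mul, ← pow_succ'] at h
      have h' := (h.trans (ih1 _ _ hQ hP))
      have h2 := two_mul_trace_mul_le ((X * Xᴴ) ^ 2 ^ k) ((Xᴴ * X) ^ 2 ^ k)
      rw [(hP.pow _).eq, (hQ.pow _).eq, ← pow_add, ← pow_add, ← two_mul, ← pow_succ',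
        trace_mul_pow_comm Xᴴ X] at h2
      linarith

theorem Matrix.IsHermitian.norm_exp_le {A : Matrix m m ℝ} (hA : A.IsHermitian) :
    ‖NormedSpace.exp A‖ ≤ Real.exp ‖A‖ := by
  obtain ⟨U, l, h1, h2, h3, h4⟩ := hA.exists_diagonalization
  have hU : U ∈ unitary (Matrix m m ℝ) := ⟨h1, h2⟩
  have hU' : Uᴴ ∈ unitary (Matrix m m ℝ) := Unitary.star_mem hU
  rw [h4, h3, exp_orthogonal_conj h2, CStarRing.norm_mul_mem_unitary _ hU',
    CStarRing.norm_mem_unitary_mul _ hU, l2_opNorm_diagonal]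
  refine (pi_norm_le_iff_of_nonneg (Real.exp_pos _).le).2 fun i => ?_
  rw [Real.norm_eq_abs, Real.abs_exp]
  exact Real.exp_le_exp.2 ((le_abs_self _).trans (norm_le_pi_norm l i))

/-- Telescoping. In the Lie product formula c = exp((‖A‖ + ‖B‖)/N), so that c ^ N stays bounded and
only the factor N has to be beaten. -/
theorem norm_pow_sub_pow_le_mul_norm_sub {𝔸 : Type*} [NormedRing 𝔸] {x y : 𝔸} {c : ℝ}
    (hc : 1 ≤ c) (h1 : ‖(1 : 𝔸)‖ ≤ 1) (hx : ‖x‖ ≤ c) (hy : ‖y‖ ≤ c) (N : ℕ) :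
    ‖x ^ N - y ^ N‖ ≤ N * c ^ N * ‖x - y‖ := by
  have hc0 : 0 ≤ c := zero_le_one.trans hc
  have hp (k : ℕ) : ‖x ^ k‖ ≤ c ^ k := by
    induction k with
    | zero => simpa using h1
    | succ k ih =>
      rw [pow_succ, pow_succ]
      exact (norm_mul_le _ _).trans (mul_le_mul ih hx (norm_nonneg _) (by positivity))
  induction N with
  | zero => simp
  | succ N ih =>
    have e : x ^ (N + 1) - y ^ (N + 1) = x ^ N * (x - y) + (x ^ N - y ^ N) * y := by
      rw [pow_succ, pow_succ]; noncomm_ring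
    have hcN : c ^ N ≤ c ^ (N + 1) := pow_le_pow_right₀ hc N.le_succ
    calc _ ≤ ‖x ^ N‖ * ‖x - y‖ + ‖x ^ N - y ^ N‖ * ‖y‖ := by
          rw [e]
          exact (norm_add_le _ _).trans (add_le_add (norm_mul_le _ _) (norm_mul_le _ _))
      _ ≤ c ^ (N + 1) * ‖x - y‖ + (N * c ^ N * ‖x - y‖) * c := by
          gcongr
          exact (hp N).trans hcN
      _ = _ := by push_cast; ring

open Filter Topology in
/-- The Lie product formula for symmetric matrices. -/
theorem Matrix.IsHermitian.tendsto_exp_mul_exp_pow {A B : Matrix m m ℝ} (hA : A.IsHermitian)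
    (hB : B.IsHermitian) :
    Tendsto (fun N : ℕ => (NormedSpace.exp ((N : ℝ)⁻¹ • A) * NormedSpace.exp ((N : ℝ)⁻¹ • B)) ^ N)
      atTop (𝓝 (NormedSpace.exp (A + B))) := by
  -- The two curves agree to first order at 0, so their difference at 1/N is o(1/N), which beats the
  -- factor N of the telescoping bound.
  have hd : HasDerivAt (fun t : ℝ => NormedSpace.exp (t • A) * NormedSpace.exp (t • B) -
      NormedSpace.exp (t • (A + B))) 0 0 := by
    have h1 := (hasDerivAt_exp_smul_const A (0 : ℝ)).mul (hasDerivAt_exp_smul_const B (0 : ℝ))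
    have h := h1.sub (hasDerivAt_exp_smul_const (A + B) (0 : ℝ))
    exact h.congr_deriv (by simp)
  have ho := hd.tendsto_slope_zero
  have hN : Tendsto (fun N : ℕ => (N : ℝ)⁻¹) atTop (𝓝[≠] 0) := by
    refine tendsto_nhdsWithin_iff.2 ⟨tendsto_inv_atTop_nhds_zero_nat, ?_⟩
    filter_upwards [eventually_gt_atTop 0] with N hN
    have : (N : ℝ) ≠ 0 := by positivity
    simpa using hN.ne'
  have h0 := (ho.comp hN).norm.const_mul (Real.exp (‖A‖ + ‖B‖))
  rw [norm_zero, mul_zero] at h0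
  rw [tendsto_iff_norm_sub_tendsto_zero]
  refine squeeze_zero' (Eventually.of_forall fun _ => norm_nonneg _) ?_ h0
  filter_upwards [eventually_gt_atTop 0] with N hN
  have hN' : (0 : ℝ) < N := by positivity
  have hNi : ‖(N : ℝ)⁻¹‖ = (N : ℝ)⁻¹ := by rw [Real.norm_eq_abs, abs_of_pos (by positivity)]
  have hone : ‖(1 : Matrix m m ℝ)‖ ≤ 1 := by
    rw [← diagonal_one, l2_opNorm_diagonal]
    exact (pi_norm_le_iff_of_nonneg zero_le_one).2 fun i => by simp
  have hs (C : Matrix m m ℝ) (hC : C.IsHermitian) : ((N : ℝ)⁻¹ • C).IsHermitian := by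
    rw [IsHermitian, conjTranspose_smul, hC.eq, star_trivial]
  have hx : ‖NormedSpace.exp ((N : ℝ)⁻¹ • A) * NormedSpace.exp ((N : ℝ)⁻¹ • B)‖ ≤
      Real.exp ((N : ℝ)⁻¹ * (‖A‖ + ‖B‖)) := by
    rw [mul_add, Real.exp_add]
    refine (norm_mul_le _ _).trans (mul_le_mul ?_ ?_ (norm_nonneg _) (Real.exp_pos _).le)
    · refine (hs A hA).norm_exp_le.trans_eq ?_
      rw [norm_smul, hNi]
    · refine (hs B hB).norm_exp_le.trans_eq ?_
      rw [norm_smul, hNi]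
  have hy : ‖NormedSpace.exp ((N : ℝ)⁻¹ • (A + B))‖ ≤ Real.exp ((N : ℝ)⁻¹ * (‖A‖ + ‖B‖)) := by
    refine (hs _ (hA.add hB)).norm_exp_le.trans (Real.exp_le_exp.2 ?_)
    rw [norm_smul, hNi]
    gcongr
    exact norm_add_le _ _
  have hc : 1 ≤ Real.exp ((N : ℝ)⁻¹ * (‖A‖ + ‖B‖)) := Real.one_le_exp (by positivity)
  have key := norm_pow_sub_pow_le_mul_norm_sub hc hone hx hy N
  have e1 : NormedSpace.exp ((N : ℝ)⁻¹ • (A + B)) ^ N = NormedSpace.exp (A + B) := by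
    rw [← Matrix.exp_nsmul, ← Nat.cast_smul_eq_nsmul ℝ, smul_smul, mul_inv_cancel₀ hN'.ne',
      one_smul]
  have e2 : Real.exp ((N : ℝ)⁻¹ * (‖A‖ + ‖B‖)) ^ N = Real.exp (‖A‖ + ‖B‖) := by
    rw [← Real.exp_nat_mul, ← mul_assoc, mul_inv_cancel₀ hN'.ne', one_mul]
  rw [e1, e2] at key
  refine key.trans_eq ?_
  simp only [Function.comp_apply, zero_add, zero_smul, NormedSpace.exp_zero, mul_one, sub_self,
    sub_zero, inv_inv, norm_smul, Real.norm_natCast]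
  ring

open Filter Topology in
/-- The Golden–Thompson inequality. -/
theorem Matrix.IsHermitian.trace_exp_add_le {A B : Matrix m m ℝ} (hA : A.IsHermitian)
    (hB : B.IsHermitian) :
    (NormedSpace.exp (A + B)).trace ≤ (NormedSpace.exp A * NormedSpace.exp B).trace := by
  -- The trace inequality is available for powers of two only, so the limit is taken along N = 2 ^
  -- k.
  have hlim := (hA.tendsto_exp_mul_exp_pow hB).comp
    (tendsto_pow_atTop_atTop_of_one_lt (one_lt_two : 1 < 2))
  have htr : Continuous (fun M : Matrix m m ℝ => M.trace) := continuous_id.matrix_trace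
  refine le_of_tendsto ((htr.tendsto _).comp hlim) (Eventually.of_forall fun k => ?_)
  have hs (C : Matrix m m ℝ) (hC : C.IsHermitian) :
      (NormedSpace.exp (((2 ^ k : ℕ) : ℝ)⁻¹ • C)).IsHermitian := by
    refine IsHermitian.exp ?_
    rw [IsHermitian, conjTranspose_smul, hC.eq, star_trivial]
  have he (C : Matrix m m ℝ) :
      NormedSpace.exp (((2 ^ k : ℕ) : ℝ)⁻¹ • C) ^ 2 ^ k = NormedSpace.exp C := by
    rw [← Matrix.exp_nsmul, ← Nat.cast_smul_eq_nsmul ℝ, smul_smul, mul_inv_cancel₀ (by positivity),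
      one_smul]
  have := (trace_pow_two_pow_le k).1 _ _ (hs A hA) (hs B hB)
  rwa [he, he] at this

/-- After Golden–Thompson the increment is isolated in one factor; the trace pairing with the
positive semidefinite exp A preserves the quadratic upper bound on the other. -/
theorem Matrix.IsHermitian.trace_exp_add_le_quadratic {A Y : Matrix m m ℝ} (hA : A.IsHermitian)
    (hY : Y.IsHermitian) (h : ‖Y‖ ≤ 1) :
    (NormedSpace.exp (A + Y)).trace ≤ (NormedSpace.exp A * (1 + Y + Y * Y)).trace := by
  have := hA.posSemidef_exp.trace_mul_nonneg (hY.posSemidef_one_add_add_sq_sub_exp h)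
  rw [mul_sub, trace_sub] at this
  linarith [hA.trace_exp_add_le hY]

/-- If `∑ q_i (Y_i + Y_i²)` is negative semidefinite, then the weighted average of
`tr exp (A + Y_i)` does not exceed `tr exp A`. -/
theorem Matrix.IsHermitian.sum_mul_trace_exp_add_le {ι : Type*} (s : Finset ι) {A : Matrix m m ℝ}
    (hA : A.IsHermitian) (q : ι → ℝ) (Y : ι → Matrix m m ℝ) (hq : ∀ i ∈ s, 0 ≤ q i)
    (hY : ∀ i ∈ s, (Y i).IsHermitian) (hY1 : ∀ i ∈ s, q i ≠ 0 → ‖Y i‖ ≤ 1)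
    (hsum : (-∑ i ∈ s, q i • (Y i + Y i * Y i)).PosSemidef) :
    ∑ i ∈ s, q i * (NormedSpace.exp (A + Y i)).trace ≤
      (∑ i ∈ s, q i) * (NormedSpace.exp A).trace := by
  have h1 := hA.posSemidef_exp.trace_mul_nonneg hsum
  have h2 : ∑ i ∈ s, q i * (NormedSpace.exp (A + Y i)).trace ≤
      ∑ i ∈ s, q i * (NormedSpace.exp A * (1 + Y i + Y i * Y i)).trace := by
    refine Finset.sum_le_sum fun i hi => ?_
    by_cases h : q i = 0
    · simp [h]
    · exact mul_le_mul_of_nonneg_left (hA.trace_exp_add_le_quadratic (hY i hi) (hY1 i hi h)) (hq i hi)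
  refine h2.trans ?_
  have h3 : ∑ i ∈ s, q i * (NormedSpace.exp A * (1 + Y i + Y i * Y i)).trace =
      (∑ i ∈ s, q i) * (NormedSpace.exp A).trace -
        (NormedSpace.exp A * -∑ i ∈ s, q i • (Y i + Y i * Y i)).trace := by
    rw [mul_neg, trace_neg, sub_neg_eq_add, Finset.mul_sum, trace_sum, Finset.sum_mul,
      ← Finset.sum_add_distrib]
    refine Finset.sum_congr rfl fun i _ => ?_
    rw [mul_smul_comm, trace_smul, add_assoc, mul_add, trace_add, mul_one, smul_eq_mul]
    ring
  rw [h3]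
  linarith

end TraceInequalities

/-! ### Conditional masses on the weighted cube -/

section WeightedCube

variable {n : ℕ}

/-- The total mass, with density `f`, of the points of the weighted cube all of whose coordinates
in `Λ` are one. -/
noncomputable def onesSum (w f : (Fin n → Fin 2) → ℝ) (Λ : Finset (Fin n)) : ℝ :=
  ∑ x, if ∀ l ∈ Λ, x l = 1 then w x * f x else 0

/-- The mass of the points of the weighted cube all of whose coordinates in `Λ` are one. -/
noncomputable def onesMass (w : (Fin n → Fin 2) → ℝ) (Λ : Finset (Fin n)) : ℝ :=
  onesSum w (fun _ => 1) Λ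

/-- The conditional mass of `x j = 1` given that all coordinates in `Λ` are one. -/
noncomputable def condMass (w : (Fin n → Fin 2) → ℝ) (Λ : Finset (Fin n)) (j : Fin n) : ℝ :=
  onesMass w (insert j Λ) / onesMass w Λ

variable {w : (Fin n → Fin 2) → ℝ}

theorem onesMass_nonneg (hw : ∀ x, 0 ≤ w x) (Λ : Finset (Fin n)) : 0 ≤ onesMass w Λ :=
  Finset.sum_nonneg fun x _ => by split_ifs <;> simp [hw x]

theorem onesMass_anti (hw : ∀ x, 0 ≤ w x) {Λ Λ' : Finset (Fin n)} (h : Λ ⊆ Λ') :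
    onesMass w Λ' ≤ onesMass w Λ := by
  refine Finset.sum_le_sum fun x _ => ?_
  by_cases h' : ∀ l ∈ Λ', x l = 1
  · rw [if_pos h', if_pos fun l hl => h' l (h hl)]
  · rw [if_neg h']
    split_ifs <;> simp [hw x]

theorem le_onesMass (hw : ∀ x, 0 ≤ w x) {Λ : Finset (Fin n)} {x : Fin n → Fin 2}
    (hx : ∀ l ∈ Λ, x l = 1) : w x ≤ onesMass w Λ := by
  have := Finset.single_le_sum
    (f := fun x : Fin n → Fin 2 => if ∀ l ∈ Λ, x l = 1 then w x * 1 else 0)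
    (fun y _ => by split_ifs <;> simp [hw y]) (Finset.mem_univ x)
  simpa [if_pos hx, onesMass, onesSum] using this

theorem onesSum_eq_zero (hw : ∀ x, 0 ≤ w x) (f : (Fin n → Fin 2) → ℝ) {Λ : Finset (Fin n)}
    (h : onesMass w Λ = 0) : onesSum w f Λ = 0 := by
  refine Finset.sum_eq_zero fun x _ => ?_
  split_ifs with hx
  · rw [le_antisymm (h ▸ le_onesMass hw hx) (hw x), zero_mul]
  · rfl

theorem onesSum_indicator (Λ : Finset (Fin n)) (j : Fin n) :
    onesSum w (fun x => if x j = 1 then 1 else 0) Λ = onesMass w (insert j Λ) := by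
  refine Finset.sum_congr rfl fun x _ => ?_
  by_cases h : x j = 1 <;> simp [h]

theorem natCast_coe_fin_two (a : Fin 2) : ((a : ℕ) : ℝ) = if a = 1 then 1 else 0 := by
  fin_cases a <;> simp

/-- Double counting of the pairs of a point and of a coordinate outside of `Λ` which is one. -/
theorem sum_onesSum_insert {k : ℕ} (hk : ∀ x, w x ≠ 0 → ∑ i, (x i : ℕ) = k)
    (f : (Fin n → Fin 2) → ℝ) (Λ : Finset (Fin n)) :
    ∑ i ∈ Λᶜ, onesSum w f (insert i Λ) = ((k : ℝ) - Λ.card) * onesSum w f Λ := by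
  simp only [onesSum]
  rw [Finset.sum_comm, Finset.mul_sum]
  refine Finset.sum_congr rfl fun x _ => ?_
  by_cases hx : ∀ l ∈ Λ, x l = 1
  · by_cases hwx : w x = 0
    · simp [hwx]
    have h1 : (∑ i, ((x i : ℕ) : ℝ)) = k := by rw [← hk x hwx]; push_cast; rfl
    rw [← Finset.sum_add_sum_compl Λ, Finset.sum_congr rfl
      (fun i hi => show ((x i : ℕ) : ℝ) = 1 by rw [natCast_coe_fin_two, if_pos (hx i hi)])] at h1
    simp only [Finset.sum_const, nsmul_eq_mul, mul_one] at h1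
    rw [if_pos hx, ← eq_sub_iff_add_eq'.2 h1, Finset.sum_mul]
    refine Finset.sum_congr rfl fun i _ => ?_
    rw [natCast_coe_fin_two]
    by_cases hi : x i = 1
    · rw [if_pos hi, one_mul, if_pos]
      simpa [hi] using hx
    · rw [if_neg hi, zero_mul, if_neg]
      simp [hi]
  · rw [if_neg hx, mul_zero]
    refine Finset.sum_eq_zero fun i _ => if_neg fun h => hx fun l hl => h l ?_
    exact Finset.mem_insert_of_mem hl

/-- Both sides are the covariance-like quantity P(i, j, Λ) - P(i, Λ) P(j, Λ) / P(Λ). This symmetry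
is what lets a one-sided row bound control the columns of the influence matrix. -/
theorem onesMass_mul_condMass_sub_comm (hw : ∀ x, 0 ≤ w x) (Λ : Finset (Fin n)) (i j : Fin n) :
    onesMass w (insert i Λ) * (condMass w (insert i Λ) j - condMass w Λ j) =
      onesMass w (insert j Λ) * (condMass w (insert j Λ) i - condMass w Λ i) := by
  have key (i j : Fin n) :
      onesMass w (insert i Λ) * (condMass w (insert i Λ) j - condMass w Λ j) =
        onesMass w (insert j (insert i Λ)) -
          onesMass w (insert i Λ) * onesMass w (insert j Λ) / onesMass w Λ := by
    rw [mul_sub, condMass, condMass, ← mul_div_assoc, ← mul_div_assoc]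
    congr 1
    by_cases h : onesMass w (insert i Λ) = 0
    · rw [h, zero_mul, zero_div]
      exact (le_antisymm (h ▸ onesMass_anti hw (Finset.subset_insert _ _))
        (onesMass_nonneg hw _)).symm
    · field_simp
  rw [key, key, Finset.insert_comm, mul_comm (onesMass w (insert i Λ))]

/-- The martingale property of the conditional probabilities of X_j. It rests on homogeneity: every
point containing Λ is counted k - |Λ| times, with or without the factor X_j. -/
theorem sum_onesMass_mul_condMass_sub {k : ℕ} (hw : ∀ x, 0 ≤ w x)
    (hk : ∀ x, w x ≠ 0 → ∑ i, (x i : ℕ) = k) {Λ : Finset (Fin n)} (hΛ : onesMass w Λ ≠ 0)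
    (j : Fin n) :
    ∑ i ∈ Λᶜ, onesMass w (insert i Λ) * (condMass w (insert i Λ) j - condMass w Λ j) = 0 := by
  have h1 := sum_onesSum_insert hk (fun x => if x j = 1 then 1 else 0) Λ
  have h2 := sum_onesSum_insert hk (fun _ => 1) Λ
  simp only [onesSum_indicator] at h1
  have h3 : ∀ i ∈ Λᶜ, onesMass w (insert i Λ) * (condMass w (insert i Λ) j - condMass w Λ j) =
      onesMass w (insert j (insert i Λ)) - onesMass w (insert i Λ) * condMass w Λ j := by
    intro i _
    rw [mul_sub, condMass]
    congr 1
    by_cases h : onesMass w (insert i Λ) = 0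
    · rw [h, zero_mul]
      exact (le_antisymm (h ▸ onesMass_anti hw (Finset.subset_insert _ _))
        (onesMass_nonneg hw _)).symm
    · field_simp
  rw [Finset.sum_congr rfl h3, Finset.sum_sub_distrib, h1, ← Finset.sum_mul]
  simp only [onesMass] at h2 hΛ ⊢
  rw [h2, condMass, onesMass, onesMass]
  field_simp
  ring

end WeightedCube

/-! ### Schur-type bound for the squared increments -/

section IncrementBound

theorem norm_sum_smul_sq_le {ι E : Type*} [NormedAddCommGroup E] [NormedSpace ℝ E] (s : Finset ι)
    (c : ι → ℝ) (a : ι → E) :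
    ‖∑ j ∈ s, c j • a j‖ ^ 2 ≤ (∑ j ∈ s, |c j|) * ∑ j ∈ s, |c j| * ‖a j‖ ^ 2 := by
  have h1 : ‖∑ j ∈ s, c j • a j‖ ≤ ∑ j ∈ s, |c j| * ‖a j‖ :=
    (norm_sum_le _ _).trans_eq (Finset.sum_congr rfl fun j _ => by rw [norm_smul, Real.norm_eq_abs])
  refine (pow_le_pow_left₀ (norm_nonneg _) h1 2).trans ?_
  refine Finset.sum_sq_le_sum_mul_sum_of_sq_le_mul s (fun j _ => abs_nonneg _)
    (fun j _ => by positivity) fun j _ => le_of_eq (by ring)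

theorem norm_add_smul_sub_sq_le {E : Type*} [NormedAddCommGroup E] [NormedSpace ℝ E]
    (θ K : ℝ) (x y z : E) :
    ‖θ • x + K • (y - z)‖ ^ 2 ≤
      3 * (θ ^ 2 * ‖x‖ ^ 2 + K ^ 2 * ‖y‖ ^ 2 + K ^ 2 * ‖z‖ ^ 2) := by
  have h1 : ‖θ • x + K • (y - z)‖ ≤ |θ| * ‖x‖ + |K| * ‖y‖ + |K| * ‖z‖ := by
    refine (norm_add_le _ _).trans ?_
    rw [norm_smul, norm_smul, Real.norm_eq_abs, Real.norm_eq_abs, add_assoc, ← mul_add]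
    gcongr
    exact norm_sub_le _ _
  refine (pow_le_pow_left₀ (norm_nonneg _) h1 2).trans ?_
  rw [← sq_abs θ, ← sq_abs K]
  nlinarith [sq_nonneg (|θ| * ‖x‖ - |K| * ‖y‖), sq_nonneg (|θ| * ‖x‖ - |K| * ‖z‖),
    sq_nonneg (|K| * ‖y‖ - |K| * ‖z‖)]

/-- The weighted sum of the squared increments is controlled by the weighted sum of the squares. -/
theorem sum_mul_norm_increment_sq_le {ι E : Type*} [Fintype ι] [NormedAddCommGroup E]
    [NormedSpace ℝ E] {s : Finset ι} {q : ι → ℝ} {I : ι → ι → ℝ} {D R θ K : ℝ} {a b : ι → E}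
    (hq : ∀ i, 0 ≤ q i) (hsymm : ∀ i j, q i * I i j = q j * I j i)
    (hzero : ∀ i ∈ s, ∀ j ∉ s, q i * I i j = 0) (hI : ∀ i, q i ≠ 0 → ∑ j, |I i j| ≤ D)
    (hab : ∀ i, ‖b i‖ ≤ R * ‖a i‖) (hK : 3 * (θ ^ 2 * D ^ 2 + K ^ 2 * R ^ 2 * D ^ 2 + K ^ 2 * R ^ 2) ≤ K) :
    ∑ i ∈ s, q i * ‖θ • (∑ j, I i j • a j) + K • ((∑ j, I i j • b j) - b i)‖ ^ 2 ≤
      K * ∑ i ∈ s, q i * ‖a i‖ ^ 2 := by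
  classical
  have hb (i : ι) : ‖b i‖ ^ 2 ≤ R ^ 2 * ‖a i‖ ^ 2 := by
    rw [← mul_pow]; exact pow_le_pow_left₀ (norm_nonneg _) (hab i) 2
  set Q := ∑ i ∈ s, q i * ‖a i‖ ^ 2 with hQ
  have hQ0 : 0 ≤ Q := Finset.sum_nonneg fun i _ => mul_nonneg (hq i) (by positivity)
  -- One factor D comes from Cauchy–Schwarz along rows. The other comes from the column sums, which
  -- the symmetry of q_i I(i,j) turns into row sums weighted by q_j.
  have hT : D * ∑ i ∈ s, q i * ∑ j, |I i j| * ‖a j‖ ^ 2 ≤ D ^ 2 * Q := by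
    have h1 : ∑ i ∈ s, q i * ∑ j, |I i j| * ‖a j‖ ^ 2 =
        ∑ j ∈ s, ‖a j‖ ^ 2 * ∑ i ∈ s, q j * |I j i| := by
      simp only [Finset.mul_sum]
      rw [Finset.sum_comm, ← Finset.sum_subset (Finset.subset_univ s)]
      · refine Finset.sum_congr rfl fun j _ => Finset.sum_congr rfl fun i _ => ?_
        rw [← abs_of_nonneg (hq i), ← abs_of_nonneg (hq j), ← abs_mul (q j), ← hsymm, abs_mul]
        ring
      · intro j _ hj
        refine Finset.sum_eq_zero fun i hi => ?_
        rw [← mul_assoc, ← abs_of_nonneg (hq i), ← abs_mul, hzero i hi j hj, abs_zero, zero_mul]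
    rw [h1, hQ, Finset.mul_sum, Finset.mul_sum]
    refine Finset.sum_le_sum fun j _ => ?_
    by_cases h : q j = 0
    · simp [h]
    have h4 : 0 ≤ D := (Finset.sum_nonneg fun i _ => abs_nonneg (I j i)).trans (hI j h)
    have h6 : ∑ i ∈ s, q j * |I j i| ≤ q j * ∑ i, |I j i| := by
      rw [← Finset.mul_sum]
      exact mul_le_mul_of_nonneg_left (Finset.sum_le_univ_sum_of_nonneg fun i => abs_nonneg _) (hq j)
    calc _ ≤ D * (‖a j‖ ^ 2 * (q j * ∑ i, |I j i|)) := by gcongr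
      _ ≤ D * (‖a j‖ ^ 2 * (q j * D)) := by
        gcongr
        · exact hq j
        · exact hI j h
      _ = _ := by ring
  have hterm : ∀ i ∈ s, q i * ‖θ • (∑ j, I i j • a j) + K • ((∑ j, I i j • b j) - b i)‖ ^ 2 ≤
      3 * (θ ^ 2 + K ^ 2 * R ^ 2) * (D * (q i * ∑ j, |I i j| * ‖a j‖ ^ 2)) +
        3 * (K ^ 2 * R ^ 2) * (q i * ‖a i‖ ^ 2) := by
    intro i _
    by_cases h : q i = 0
    · simp [h]
    have h0 : 0 ≤ ∑ j, |I i j| * ‖a j‖ ^ 2 := Finset.sum_nonneg fun j _ => by positivity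
    have h1 : ‖∑ j, I i j • a j‖ ^ 2 ≤ D * ∑ j, |I i j| * ‖a j‖ ^ 2 :=
      (norm_sum_smul_sq_le _ _ _).trans (mul_le_mul_of_nonneg_right (hI i h) h0)
    have h2 : ‖∑ j, I i j • b j‖ ^ 2 ≤ R ^ 2 * (D * ∑ j, |I i j| * ‖a j‖ ^ 2) := by
      have h3 : ∑ j, |I i j| * ‖b j‖ ^ 2 ≤ R ^ 2 * ∑ j, |I i j| * ‖a j‖ ^ 2 := by
        rw [Finset.mul_sum]
        refine Finset.sum_le_sum fun j _ => ?_
        nlinarith [mul_le_mul_of_nonneg_left (hb j) (abs_nonneg (I i j))]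
      have h4 : 0 ≤ D := (Finset.sum_nonneg fun j _ => abs_nonneg (I i j)).trans (hI i h)
      calc _ ≤ _ := norm_sum_smul_sq_le _ _ _
        _ ≤ D * (R ^ 2 * ∑ j, |I i j| * ‖a j‖ ^ 2) := by gcongr; exact hI i h
        _ = _ := by ring
    have h5 := norm_add_smul_sub_sq_le θ K (∑ j, I i j • a j) (∑ j, I i j • b j) (b i)
    calc _ ≤ q i * (3 * (θ ^ 2 * (D * ∑ j, |I i j| * ‖a j‖ ^ 2) +
          K ^ 2 * (R ^ 2 * (D * ∑ j, |I i j| * ‖a j‖ ^ 2)) + K ^ 2 * (R ^ 2 * ‖a i‖ ^ 2))) := by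
          refine mul_le_mul_of_nonneg_left (h5.trans ?_) (hq i)
          gcongr
          exact hb i
      _ = _ := by ring
  refine (Finset.sum_le_sum hterm).trans ?_
  rw [Finset.sum_add_distrib, ← Finset.mul_sum, ← Finset.mul_sum, ← Finset.mul_sum, ← hQ]
  calc _ ≤ 3 * (θ ^ 2 + K ^ 2 * R ^ 2) * (D ^ 2 * Q) + 3 * (K ^ 2 * R ^ 2) * Q := by gcongr
    _ = 3 * (θ ^ 2 * D ^ 2 + K ^ 2 * R ^ 2 * D ^ 2 + K ^ 2 * R ^ 2) * Q := by ring
    _ ≤ _ := by gcongr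

end IncrementBound

/-! ### The supermartingale step and the induction over conditionings -/

section MatrixMoments

open Matrix

variable {n d : ℕ}

theorem Matrix.IsHermitian.real_smul {p : Type*} {A : Matrix p p ℝ} (hA : A.IsHermitian) (c : ℝ) :
    (c • A).IsHermitian := by
  rw [IsHermitian, conjTranspose_smul, hA.eq, star_trivial]

theorem Matrix.IsHermitian.mul_self {p : Type*} [Fintype p] {A : Matrix p p ℝ}
    (hA : A.IsHermitian) : (A * A).IsHermitian := by
  rw [IsHermitian, conjTranspose_mul, hA.eq]

theorem Matrix.isHermitian_finset_sum {ι p : Type*} (s : Finset ι) {A : ι → Matrix p p ℝ}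
    (hA : ∀ i ∈ s, (A i).IsHermitian) : (∑ i ∈ s, A i).IsHermitian := by
  rw [IsHermitian, conjTranspose_sum]
  exact Finset.sum_congr rfl fun i hi => (hA i hi).eq

theorem Matrix.IsHermitian.dotProduct_mul_self_mulVec {A : Matrix (Fin d) (Fin d) ℝ}
    (hA : A.IsHermitian) (v : Fin d → ℝ) :
    v ⬝ᵥ ((A * A) *ᵥ v) = ‖WithLp.toLp 2 (A *ᵥ v)‖ ^ 2 := by
  have hA' : Aᵀ = A := by simpa [IsHermitian, conjTranspose] using hA
  rw [EuclideanSpace.real_norm_sq_eq, ← mulVec_mulVec, dotProduct_mulVec, ← mulVec_transpose, hA',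
    dotProduct]
  exact Finset.sum_congr rfl fun i _ => (pow_two _).symm

/-- A weighted sum of increments, with the drift `-K A_i²`, dominates its quadratic part. -/
theorem posSemidef_neg_sum_increment {s : Finset (Fin n)} {q : Fin n → ℝ} {I : Fin n → Fin n → ℝ}
    {D R θ K : ℝ} {A : Fin n → Matrix (Fin d) (Fin d) ℝ} (hA : ∀ i, (A i).IsHermitian)
    (hR : ∀ i, ‖A i‖ ≤ R)
    (hq : ∀ i, 0 ≤ q i) (hsymm : ∀ i j, q i * I i j = q j * I j i)
    (hzero : ∀ i ∈ s, ∀ j ∉ s, q i * I i j = 0) (hmean : ∀ j, ∑ i ∈ s, q i * I i j = 0)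
    (hI : ∀ i, q i ≠ 0 → ∑ j, |I i j| ≤ D)
    (hK : 3 * (θ ^ 2 * D ^ 2 + K ^ 2 * R ^ 2 * D ^ 2 + K ^ 2 * R ^ 2) ≤ K)
    {Y : Fin n → Matrix (Fin d) (Fin d) ℝ} (hYh : ∀ i, (Y i).IsHermitian)
    (hY : ∀ i, Y i = θ • (∑ j, I i j • A j) + K • ((∑ j, I i j • (A j * A j)) - A i * A i)) :
    (-∑ i ∈ s, q i • (Y i + Y i * Y i)).PosSemidef := by
  have hfirst (B : Fin n → Matrix (Fin d) (Fin d) ℝ) :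
      -- The influence terms have mean zero for any matrices B, hence only the drift survives in the
      -- linear part.
      ∑ i ∈ s, q i • ∑ j, I i j • B j = 0 := by
    simp only [Finset.smul_sum, smul_smul]
    rw [Finset.sum_comm]
    simp only [← Finset.sum_smul, hmean, zero_smul, Finset.sum_const_zero]
  have hlin : ∑ i ∈ s, q i • Y i = -(K • ∑ i ∈ s, q i • (A i * A i)) := by
    simp only [hY, smul_add, smul_sub, Finset.sum_add_distrib, Finset.sum_sub_distrib]
    simp only [smul_comm (q _) θ, smul_comm (q _) K, ← Finset.smul_sum, hfirst]
    simp
  have hrw : -∑ i ∈ s, q i • (Y i + Y i * Y i) =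
      K • (∑ i ∈ s, q i • (A i * A i)) - ∑ i ∈ s, q i • (Y i * Y i) := by
    simp only [smul_add, Finset.sum_add_distrib, hlin]
    abel
  rw [hrw]
  refine PosSemidef.of_dotProduct_mulVec_nonneg (IsHermitian.sub ?_ ?_) fun v => ?_
  · exact (isHermitian_finset_sum s fun i _ => ((hA i).mul_self.real_smul _)).real_smul _
  · exact isHermitian_finset_sum s fun i _ => ((hYh i).mul_self.real_smul _)
  -- Tested on a vector v, the matrix inequality becomes the scalar estimate for the vectors a_i =
  -- A_i v and b_i = A_i² v.
  have hab (i : Fin n) : ‖WithLp.toLp 2 ((A i * A i) *ᵥ v)‖ ≤ R * ‖WithLp.toLp 2 (A i *ᵥ v)‖ := by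
    rw [← mulVec_mulVec]
    exact (l2_opNorm_mulVec (A i) (WithLp.toLp 2 (A i *ᵥ v))).trans
      (mul_le_mul_of_nonneg_right (hR i) (norm_nonneg _))
  have key := sum_mul_norm_increment_sq_le hq hsymm hzero hI hab hK
  have hYv (i : Fin n) : WithLp.toLp 2 (Y i *ᵥ v) =
      θ • (∑ j, I i j • WithLp.toLp 2 (A j *ᵥ v)) +
        K • ((∑ j, I i j • WithLp.toLp 2 ((A j * A j) *ᵥ v)) - WithLp.toLp 2 ((A i * A i) *ᵥ v)) := by
    rw [hY]
    simp only [add_mulVec, smul_mulVec, sub_mulVec, sum_mulVec, ← WithLp.toLp_smul,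
      ← WithLp.toLp_sum, ← WithLp.toLp_sub, ← WithLp.toLp_add]
  simp only [← hYv] at key
  simp only [star_trivial, sub_mulVec, smul_mulVec, sum_mulVec, dotProduct_sub, dotProduct_smul,
    dotProduct_sum, smul_eq_mul, (hYh _).dotProduct_mul_self_mulVec,
    (hA _).dotProduct_mul_self_mulVec]
  linarith

theorem norm_increment_le {I : Fin n → ℝ} {D R θ K : ℝ} {A : Fin n → Matrix (Fin d) (Fin d) ℝ}
    (hR : ∀ i, ‖A i‖ ≤ R) (hI : ∑ j, |I j| ≤ D) (hK : 0 ≤ K) (i : Fin n) :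
    ‖θ • (∑ j, I j • A j) + K • ((∑ j, I j • (A j * A j)) - A i * A i)‖ ≤
      |θ| * (D * R) + K * (D * R ^ 2 + R ^ 2) := by
  have hR0 : 0 ≤ R := (norm_nonneg _).trans (hR i)
  have hsq (j : Fin n) : ‖A j * A j‖ ≤ R ^ 2 :=
    (norm_mul_le _ _).trans ((mul_le_mul (hR j) (hR j) (norm_nonneg _) hR0).trans_eq (pow_two R).symm)
  have hsum {B : Fin n → Matrix (Fin d) (Fin d) ℝ} {r : ℝ} (hr : 0 ≤ r) (hB : ∀ j, ‖B j‖ ≤ r) :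
      ‖∑ j, I j • B j‖ ≤ D * r := by
    calc _ ≤ ∑ j, |I j| * r := (norm_sum_le _ _).trans (Finset.sum_le_sum fun j _ => by
          rw [norm_smul, Real.norm_eq_abs]; gcongr; exact hB j)
      _ ≤ _ := by rw [← Finset.sum_mul]; gcongr
  refine (norm_add_le _ _).trans ?_
  rw [norm_smul, norm_smul, Real.norm_eq_abs, Real.norm_eq_abs, abs_of_nonneg hK]
  gcongr
  · exact hsum hR0 hR
  · exact (norm_sub_le _ _).trans (add_le_add (hsum (by positivity) hsq) (hsq i))

/-- The conditional mean of `∑ i, X_i A_i` given that all coordinates in `Λ` are one. -/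
noncomputable def condMean (w : (Fin n → Fin 2) → ℝ) (A : Fin n → Matrix (Fin d) (Fin d) ℝ)
    (Λ : Finset (Fin n)) : Matrix (Fin d) (Fin d) ℝ :=
  ∑ j, condMass w Λ j • A j

/-- The conditional mean of `∑ i ∉ Λ, X_i A_i²` given that all coordinates in `Λ` are one. -/
noncomputable def condSquare (w : (Fin n → Fin 2) → ℝ) (A : Fin n → Matrix (Fin d) (Fin d) ℝ)
    (Λ : Finset (Fin n)) : Matrix (Fin d) (Fin d) ℝ :=
  ∑ j, condMass w Λ j • (A j * A j) - ∑ j ∈ Λ, A j * A j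

variable {w : (Fin n → Fin 2) → ℝ} {A : Fin n → Matrix (Fin d) (Fin d) ℝ}

theorem isHermitian_condMean (hA : ∀ i, (A i).IsHermitian) (Λ : Finset (Fin n)) :
    (condMean w A Λ).IsHermitian :=
  isHermitian_finset_sum _ fun i _ => (hA i).real_smul _

theorem isHermitian_condSquare (hA : ∀ i, (A i).IsHermitian) (Λ : Finset (Fin n)) :
    (condSquare w A Λ).IsHermitian :=
  (isHermitian_finset_sum _ fun i _ => (hA i).mul_self.real_smul _).sub
    (isHermitian_finset_sum _ fun i _ => (hA i).mul_self)

/-- The base of the induction, with equality: k ones already fill Λ, so the only point of positive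
mass is the indicator of Λ; there the conditional mean is Z itself and no variance is left. -/
theorem onesSum_exp_le_of_card_eq {k : ℕ} (hw : ∀ x, 0 ≤ w x)
    (hk : ∀ x, w x ≠ 0 → ∑ i, (x i : ℕ) = k) (H : Matrix (Fin d) (Fin d) ℝ) (θ K : ℝ)
    {Λ : Finset (Fin n)} (hcard : Λ.card = k) (hΛ : onesMass w Λ ≠ 0) :
    onesSum w (fun x => (NormedSpace.exp (H + θ • ∑ i, ((x i : ℕ) : ℝ) • A i)).trace) Λ ≤
      onesMass w Λ * (NormedSpace.exp (H + θ • condMean w A Λ + K • condSquare w A Λ)).trace := by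
  have h0 : ∀ i ∈ Λᶜ, onesMass w (insert i Λ) = 0 := by
    have h := sum_onesSum_insert hk (fun _ => 1) Λ
    rw [hcard, sub_self, zero_mul] at h
    exact (Finset.sum_eq_zero_iff_of_nonneg fun i _ => onesMass_nonneg hw _).1 h
  have hc (j : Fin n) : condMass w Λ j = if j ∈ Λ then 1 else 0 := by
    split_ifs with hj
    · rw [condMass, Finset.insert_eq_of_mem hj, div_self hΛ]
    · rw [condMass, h0 j (by simpa using hj), zero_div]
  have hM : condMean w A Λ = ∑ j ∈ Λ, A j := by simp [condMean, hc]
  have hW : condSquare w A Λ = 0 := by simp [condSquare, hc]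
  rw [hM, hW, smul_zero, add_zero]
  refine le_of_eq ?_
  rw [onesMass, onesSum, onesSum, Finset.sum_mul]
  refine Finset.sum_congr rfl fun x _ => ?_
  split_ifs with hx
  · by_cases hwx : w x = 0
    · simp [hwx]
    have hxi (i : Fin n) : ((x i : ℕ) : ℝ) = if i ∈ Λ then 1 else 0 := by
      split_ifs with hi
      · rw [natCast_coe_fin_two, if_pos (hx i hi)]
      · rw [natCast_coe_fin_two, if_neg]
        intro hxi
        have h1 : w x ≤ onesMass w (insert i Λ) := le_onesMass hw (by simpa [hxi] using hx)
        rw [h0 i (by simpa using hi)] at h1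
        exact hwx (le_antisymm h1 (hw x))
    simp [hxi]
  · simp

/-- The conditional matrix Laplace transform bound, by downward induction on the number of
coordinates which are conditioned to be one. -/
theorem onesSum_exp_le {k : ℕ} (hw : ∀ x, 0 ≤ w x) (hk : ∀ x, w x ≠ 0 → ∑ i, (x i : ℕ) = k)
    {D R θ K : ℝ} (hA : ∀ i, (A i).IsHermitian) (hR : ∀ i, ‖A i‖ ≤ R)
    (hI : ∀ Λ i, onesMass w (insert i Λ) ≠ 0 →
      ∑ j, |condMass w (insert i Λ) j - condMass w Λ j| ≤ D)
    (hK0 : 0 ≤ K) (hK1 : |θ| * (D * R) + K * (D * R ^ 2 + R ^ 2) ≤ 1)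
    (hK : 3 * (θ ^ 2 * D ^ 2 + K ^ 2 * R ^ 2 * D ^ 2 + K ^ 2 * R ^ 2) ≤ K)
    {H : Matrix (Fin d) (Fin d) ℝ} (hH : H.IsHermitian) (r : ℕ) :
    ∀ Λ : Finset (Fin n), Λ.card + r = k → onesMass w Λ ≠ 0 →
      onesSum w (fun x => (NormedSpace.exp (H + θ • ∑ i, ((x i : ℕ) : ℝ) • A i)).trace) Λ ≤
        onesMass w Λ *
          (NormedSpace.exp (H + θ • condMean w A Λ + K • condSquare w A Λ)).trace := by
  induction r with
  | zero => exact fun Λ hcard hΛ => onesSum_exp_le_of_card_eq hw hk H θ K hcard hΛ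
  | succ r ih =>
    intro Λ hcard hΛ
    have hr : (k : ℝ) - Λ.card = r + 1 := by rw [← hcard]; push_cast; ring
    set f := fun x : Fin n → Fin 2 =>
      (NormedSpace.exp (H + θ • ∑ i, ((x i : ℕ) : ℝ) • A i)).trace
    set B := H + θ • condMean w A Λ + K • condSquare w A Λ with hB
    have hBh : B.IsHermitian := (hH.add ((isHermitian_condMean hA Λ).real_smul _)).add
      ((isHermitian_condSquare hA Λ).real_smul _)
    set I : Fin n → Fin n → ℝ := fun i j => condMass w (insert i Λ) j - condMass w Λ j
    set q : Fin n → ℝ := fun i => onesMass w (insert i Λ)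
    set Y : Fin n → Matrix (Fin d) (Fin d) ℝ := fun i =>
      θ • (∑ j, I i j • A j) + K • ((∑ j, I i j • (A j * A j)) - A i * A i)
    have hYh (i : Fin n) : (Y i).IsHermitian :=
      ((isHermitian_finset_sum _ fun j _ => (hA j).real_smul _).real_smul _).add
        (((isHermitian_finset_sum _ fun j _ => (hA j).mul_self.real_smul _).sub
          (hA i).mul_self).real_smul _)
    -- As i ∉ Λ, passing to `insert i Λ` removes A_i² from the remaining variance: this is the
    -- source of the drift.
    have hBY : ∀ i ∈ Λᶜ, H + θ • condMean w A (insert i Λ) + K • condSquare w A (insert i Λ) =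
        B + Y i := by
      intro i hi
      simp only [hB, Y, I, condMean, condSquare, sub_smul, Finset.sum_sub_distrib,
        Finset.sum_insert (Finset.mem_compl.1 hi), smul_sub, smul_add]
      abel
    have hq (i : Fin n) : 0 ≤ q i := onesMass_nonneg hw _
    have hzero : ∀ i ∈ Λᶜ, ∀ j ∉ Λᶜ, q i * I i j = 0 := by
      intro i _ j hj
      have hj' : j ∈ Λ := by simpa using hj
      by_cases h : q i = 0
      · rw [h, zero_mul]
      · simp only [I, condMass, Finset.insert_eq_of_mem hj',
          Finset.insert_eq_of_mem (Finset.mem_insert_of_mem hj')]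
        rw [div_self hΛ, div_self h, sub_self, mul_zero]
    have hpsd := posSemidef_neg_sum_increment hA hR hq
      (onesMass_mul_condMass_sub_comm hw Λ) hzero (sum_onesMass_mul_condMass_sub hw hk hΛ)
      (hI Λ) hK hYh fun _ => rfl
    have hstep := hBh.sum_mul_trace_exp_add_le Λᶜ q Y (fun i _ => hq i) (fun i _ => hYh i)
      (fun i _ h => (norm_increment_le hR (hI Λ i h) hK0 i).trans hK1) hpsd
    have hsum1 := sum_onesSum_insert hk f Λ
    have hsum2 : ∑ i ∈ Λᶜ, q i = _ := sum_onesSum_insert hk (fun _ => 1) Λ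
    rw [hr] at hsum1 hsum2
    have hle : ∑ i ∈ Λᶜ, onesSum w f (insert i Λ) ≤
        ∑ i ∈ Λᶜ, q i * (NormedSpace.exp (B + Y i)).trace := by
      refine Finset.sum_le_sum fun i hi => ?_
      by_cases h : q i = 0
      · rw [h, zero_mul, onesSum_eq_zero hw f h]
      · rw [← hBY i hi]
        refine ih _ ?_ h
        rw [Finset.card_insert_of_notMem (Finset.mem_compl.1 hi)]
        omega
    -- Double counting puts the same factor k - |Λ| = r + 1 > 0 on both sides, and it cancels.
    have hfin := hle.trans hstep
    rw [hsum1, hsum2, mul_assoc] at hfin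
    exact le_of_mul_le_mul_left hfin (by positivity)

end MatrixMoments

/-! ### Rigidity for small independence parameter -/

section PointMass

variable {n : ℕ} {w : (Fin n → Fin 2) → ℝ}

/-- Inclusion–exclusion. Two events that each take more than half of the mass must meet. -/
theorem onesMass_insert_add_le (hw : ∀ x, 0 ≤ w x) (Λ : Finset (Fin n)) (i j : Fin n) :
    onesMass w (insert i Λ) + onesMass w (insert j Λ) ≤
      onesMass w Λ + onesMass w (insert i (insert j Λ)) := by
  simp only [onesMass, onesSum]
  rw [← Finset.sum_add_distrib, ← Finset.sum_add_distrib]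
  refine Finset.sum_le_sum fun x _ => ?_
  have := hw x
  by_cases h : ∀ l ∈ Λ, x l = 1 <;> by_cases hi : x i = 1 <;> by_cases hj : x j = 1 <;>
    simp [hi, hj] <;> split_ifs <;> simp [this]

theorem exists_ne_zero_of_onesMass_ne_zero {Λ : Finset (Fin n)} (h : onesMass w Λ ≠ 0) :
    ∃ x, w x ≠ 0 ∧ ∀ l ∈ Λ, x l = 1 := by
  obtain ⟨x, -, hx⟩ := Finset.exists_ne_zero_of_sum_ne_zero h
  split_ifs at hx with h1
  · exact ⟨x, by simpa using hx, h1⟩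
  · exact absurd rfl hx

theorem exists_eq_one_and_ne_one {k : ℕ} {x y : Fin n → Fin 2} (hx : ∑ i, (x i : ℕ) = k)
    (hy : ∑ i, (y i : ℕ) = k) (hne : x ≠ y) : ∃ i, x i = 1 ∧ y i ≠ 1 := by
  by_contra! h
  refine hne (funext fun i => Fin.ext ?_)
  have hle (i : Fin n) : (x i : ℕ) ≤ y i := by
    by_cases hi : x i = 1
    · rw [hi, h i hi]
    · have : (x i : ℕ) ≠ 1 := fun h => hi (Fin.ext h)
      omega
  exact (Finset.sum_eq_sum_iff_of_le fun i _ => hle i).1 (hx.trans hy.symm) i (Finset.mem_univ i)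

/-- If the independence parameter is less than one half, a homogeneous law is a point mass. -/
theorem eq_of_condMass_sub_lt_half {k : ℕ} (hw : ∀ x, 0 ≤ w x)
    (hk : ∀ x, w x ≠ 0 → ∑ i, (x i : ℕ) = k)
    (hI : ∀ Λ i, onesMass w (insert i Λ) ≠ 0 →
      ∑ j, |condMass w (insert i Λ) j - condMass w Λ j| < 1 / 2)
    {x y : Fin n → Fin 2} (hx : w x ≠ 0) (hy : w y ≠ 0) : x = y := by
  -- Induction on the number of common ones, counted downwards: r bounds the distance to the
  -- impossible value n + 1.
  suffices h : ∀ r : ℕ, ∀ x y : Fin n → Fin 2, w x ≠ 0 → w y ≠ 0 →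
      n < (Finset.univ.filter fun l => x l = 1 ∧ y l = 1).card + r → x = y from
    h (n + 1) x y hx hy (by omega)
  clear hx hy x y
  intro r
  induction r with
  | zero =>
    intro x y _ _ h
    have := Finset.card_le_univ (Finset.univ.filter fun l => x l = 1 ∧ y l = 1)
    rw [Fintype.card_fin] at this
    omega
  | succ r ih =>
    intro x y hx hy hr
    by_contra hne
    obtain ⟨i, hxi, hyi⟩ := exists_eq_one_and_ne_one (hk x hx) (hk y hy) hne
    obtain ⟨j, hyj, hxj⟩ := exists_eq_one_and_ne_one (hk y hy) (hk x hx) (Ne.symm hne)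
    set Λ := Finset.univ.filter fun l => x l = 1 ∧ y l = 1 with hΛ
    -- The diagonal influence is 1 - P(X_i = 1 | X_Λ = 1); being less than 1/2, it forces this
    -- conditional probability above 1/2.
    have half (i : Fin n) (z : Fin n → Fin 2) (hz : w z ≠ 0) (h : ∀ l ∈ insert i Λ, z l = 1) :
        onesMass w Λ < 2 * onesMass w (insert i Λ) := by
      have h1 : 0 < onesMass w (insert i Λ) :=
        ((hw z).lt_of_ne' hz).trans_le (le_onesMass hw h)
      have h2 : 0 < onesMass w Λ := h1.trans_le (onesMass_anti hw (Finset.subset_insert _ _))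
      have h3 := (Finset.single_le_sum (f := fun j => |condMass w (insert i Λ) j - condMass w Λ j|)
        (fun j _ => abs_nonneg _) (Finset.mem_univ i)).trans_lt (hI Λ i h1.ne')
      have h4 : condMass w (insert i Λ) i = 1 := by
        rw [condMass, Finset.insert_idem, div_self h1.ne']
      have h5 := (abs_lt.1 h3).2
      rw [h4, condMass] at h5
      have h6 : 1 / 2 < onesMass w (insert i Λ) / onesMass w Λ := by linarith
      rw [div_lt_div_iff₀ two_pos h2] at h6
      linarith
    have hi := half i x hx (by simp +contextual [hxi, hΛ])
    have hj := half j y hy (by simp +contextual [hyj, hΛ])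
    have hpos : onesMass w (insert i (insert j Λ)) ≠ 0 := by
      have := onesMass_insert_add_le hw Λ i j
      intro h
      linarith
    -- The point z shares Λ and also i with x, so x = z by induction; but z has a one at j and x
    -- does not.
    obtain ⟨z, hz, hz1⟩ := exists_ne_zero_of_onesMass_ne_zero hpos
    have hxz : x = z := by
      refine ih x z hx hz ?_
      have hsub : insert i Λ ⊆ Finset.univ.filter fun l => x l = 1 ∧ z l = 1 := by
        intro l hl
        rw [Finset.mem_filter]
        refine ⟨Finset.mem_univ l, ?_, hz1 l ?_⟩
        · rcases Finset.mem_insert.1 hl with rfl | hl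
          · exact hxi
          · exact (Finset.mem_filter.1 hl).2.1
        · rcases Finset.mem_insert.1 hl with rfl | hl
          · exact Finset.mem_insert_self _ _
          · exact Finset.mem_insert_of_mem (Finset.mem_insert_of_mem hl)
      have hcard := Finset.card_le_card hsub
      rw [Finset.card_insert_of_notMem (by simp [hΛ, hyi])] at hcard
      omega
    exact hxj (hxz ▸ hz1 j (by simp))

end PointMass

/-! ### Laplace transform and tail bound on the weighted cube -/

section WeightedTail

open Matrix

variable {n d : ℕ} {w : (Fin n → Fin 2) → ℝ} {A : Fin n → Matrix (Fin d) (Fin d) ℝ}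

theorem onesSum_empty (f : (Fin n → Fin 2) → ℝ) : onesSum w f ∅ = ∑ x, w x * f x := by
  simp [onesSum]

/-- The matrix Laplace transform bound for a homogeneous law with independence parameter at least
one half. -/
theorem sum_mul_trace_exp_le {k : ℕ} (hw : ∀ x, 0 ≤ w x) (hw1 : ∑ x, w x = 1)
    (hk : ∀ x, w x ≠ 0 → ∑ i, (x i : ℕ) = k) {D R s : ℝ} (hA : ∀ i, (A i).IsHermitian)
    (hR : ∀ i, ‖A i‖ ≤ R) (hR0 : 0 ≤ R)
    (hI : ∀ Λ i, onesMass w (insert i Λ) ≠ 0 →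
      ∑ j, |condMass w (insert i Λ) j - condMass w Λ j| ≤ D)
    (hD : 1 / 2 ≤ D) (hs : |s| * D ^ 2 * R ≤ 1 / 14) :
    ∑ x, w x * (NormedSpace.exp
        (s • ((∑ i, ((x i : ℕ) : ℝ) • A i) - condMean w A ∅))).trace ≤
      d * Real.exp (6 * s ^ 2 * D ^ 2 * ‖condSquare w A ∅‖) := by
  have hmass : onesMass w ∅ = 1 := by simp [onesMass, onesSum_empty, hw1]
  have hcard : (∅ : Finset (Fin n)).card + k = k := by simp
  have hu0 : 0 ≤ |s| * D ^ 2 * R := by positivity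
  -- The lower bound on D enters here and in the analogous bounds below: powers of D less than two
  -- are absorbed into D².
  have hD4 : 1 ≤ 4 * D ^ 2 := by nlinarith
  have hu2 : s ^ 2 * D ^ 4 * R ^ 2 ≤ 1 / 196 := by
    have h := pow_le_pow_left₀ hu0 hs 2
    rw [mul_pow, mul_pow, sq_abs] at h
    calc _ = s ^ 2 * (D ^ 2) ^ 2 * R ^ 2 := by ring
      _ ≤ _ := h
      _ = _ := by norm_num
  have hK1 : |s| * (D * R) + 6 * s ^ 2 * D ^ 2 * (D * R ^ 2 + R ^ 2) ≤ 1 := by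
    have h1 : |s| * (D * R) ≤ 2 * (|s| * D ^ 2 * R) := by
      have : D ≤ 2 * D ^ 2 := by nlinarith
      have h := mul_le_mul_of_nonneg_left this (mul_nonneg (abs_nonneg s) hR0)
      linarith
    have h2 : D + 1 ≤ 6 * D ^ 2 := by nlinarith
    have h3 := mul_le_mul_of_nonneg_left h2 (show 0 ≤ s ^ 2 * D ^ 2 * R ^ 2 by positivity)
    linarith
  -- With 1 ≤ 4D² and s²D⁴R² ≤ 1/196 the left side is at most 3 (1 + 36 · 5/196) s²D², and 180/196 <
  -- 1.
  have hK : 3 * (s ^ 2 * D ^ 2 + (6 * s ^ 2 * D ^ 2) ^ 2 * R ^ 2 * D ^ 2 +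
      (6 * s ^ 2 * D ^ 2) ^ 2 * R ^ 2) ≤ 6 * s ^ 2 * D ^ 2 := by
    have h1 := mul_le_mul_of_nonneg_left hD4
      (show 0 ≤ (6 * s ^ 2 * D ^ 2) ^ 2 * R ^ 2 by positivity)
    have h2 := mul_le_mul_of_nonneg_left hu2 (show 0 ≤ s ^ 2 * D ^ 2 by positivity)
    have h3 : 0 ≤ s ^ 2 * D ^ 2 := by positivity
    linarith
  -- The choice H = -s 𝔼Z cancels the conditional mean at Λ = ∅, so only the variance term remains
  -- on the right.
  have h := onesSum_exp_le hw hk hA hR hI (θ := s) (K := 6 * s ^ 2 * D ^ 2) (by positivity) hK1 hK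
    (H := (-s) • condMean w A ∅) ((isHermitian_condMean hA ∅).real_smul _) k ∅ hcard
    (by rw [hmass]; exact one_ne_zero)
  rw [onesSum_empty, hmass, one_mul] at h
  have e1 (Z : Matrix (Fin d) (Fin d) ℝ) :
      (-s) • condMean w A ∅ + s • Z = s • (Z - condMean w A ∅) := by
    rw [neg_smul, smul_sub]; abel
  simp only [e1] at h
  rw [sub_self, smul_zero, zero_add] at h
  refine h.trans ((((isHermitian_condSquare hA ∅).real_smul _).trace_exp_le).trans_eq ?_)
  rw [Fintype.card_fin, norm_smul, Real.norm_eq_abs, abs_of_nonneg (by positivity)]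

/-- The matrix Bernstein inequality on the weighted cube. -/
theorem sum_ite_norm_le {k : ℕ} (hw : ∀ x, 0 ≤ w x) (hw1 : ∑ x, w x = 1)
    (hk : ∀ x, w x ≠ 0 → ∑ i, (x i : ℕ) = k) {D R t e : ℝ} (hA : ∀ i, (A i).IsHermitian)
    (hR : ∀ i, ‖A i‖ ≤ R) (hR0 : 0 ≤ R)
    (hI : ∀ Λ i, onesMass w (insert i Λ) ≠ 0 →
      ∑ j, |condMass w (insert i Λ) j - condMass w Λ j| ≤ D)
    (hD : 1 / 2 ≤ D) (ht : 0 < t) (he : 0 ≤ e) (heR : 28 * D ^ 2 * e * R ≤ t)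
    (heσ : 28 * D ^ 2 * e * ‖condSquare w A ∅‖ ≤ t ^ 2) :
    ∑ x, (if t ≤ ‖(∑ i, ((x i : ℕ) : ℝ) • A i) - condMean w A ∅‖ then w x else 0) ≤
      2 * d * Real.exp (-e) := by
  rcases Nat.eq_zero_or_pos d with rfl | hd
  · have h (x : Fin n → Fin 2) : ¬ t ≤ ‖(∑ i, ((x i : ℕ) : ℝ) • A i) - condMean w A ∅‖ := by
      rw [Subsingleton.elim ((∑ i, ((x i : ℕ) : ℝ) • A i) - condMean w A ∅) 0, norm_zero]
      exact not_le.2 ht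
    simp [h]
  have : Nonempty (Fin d) := ⟨⟨0, hd⟩⟩
  -- This gives exp(-st) = exp(-2e). The constant 28 makes |s| D² R ≤ 2/28 and the variance exponent
  -- at most (24/28) e ≤ e, leaving exp(-e).
  set s := 2 * e / t with hs
  have hs0 : 0 ≤ s := by positivity
  have hst : s * t = 2 * e := by rw [hs]; field_simp
  have hsR : |s| * D ^ 2 * R ≤ 1 / 14 := by
    rw [abs_of_nonneg hs0, hs, div_mul_eq_mul_div, div_mul_eq_mul_div, div_le_iff₀ ht]
    linarith
  have hsσ : 6 * s ^ 2 * D ^ 2 * ‖condSquare w A ∅‖ ≤ e := by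
    have h : 6 * s ^ 2 * D ^ 2 * ‖condSquare w A ∅‖ =
        24 * e * (D ^ 2 * e * ‖condSquare w A ∅‖) / t ^ 2 := by
      rw [hs]; field_simp; ring
    rw [h, div_le_iff₀ (by positivity)]
    have h1 := mul_le_mul_of_nonneg_left heσ he
    have h2 : 0 ≤ e * (D ^ 2 * e * ‖condSquare w A ∅‖) := by positivity
    linarith
  have hp := sum_mul_trace_exp_le hw hw1 hk hA hR hR0 hI hD hsR
  have hn := sum_mul_trace_exp_le (s := -s) hw hw1 hk hA hR hR0 hI hD (by rwa [abs_neg])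
  rw [neg_sq] at hn
  have hterm (x : Fin n → Fin 2) :
      (if t ≤ ‖(∑ i, ((x i : ℕ) : ℝ) • A i) - condMean w A ∅‖ then w x else 0) ≤
        Real.exp (-(s * t)) * (w x * (NormedSpace.exp
          (s • ((∑ i, ((x i : ℕ) : ℝ) • A i) - condMean w A ∅))).trace + w x * (NormedSpace.exp
          ((-s) • ((∑ i, ((x i : ℕ) : ℝ) • A i) - condMean w A ∅))).trace) := by
    have hZ : ((∑ i, ((x i : ℕ) : ℝ) • A i) - condMean w A ∅).IsHermitian :=
      (isHermitian_finset_sum _ fun i _ => (hA i).real_smul _).sub (isHermitian_condMean hA ∅)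
    have h1 := hZ.exp_norm_le_trace_exp s
    rw [← mul_add]
    split_ifs with h
    · have h2 : Real.exp (s * t) ≤ _ :=
        (Real.exp_le_exp.2 (mul_le_mul_of_nonneg_left h hs0)).trans h1
      calc w x = Real.exp (-(s * t)) * (w x * Real.exp (s * t)) := by
            rw [mul_left_comm, ← Real.exp_add]; simp
        _ ≤ _ := by
            gcongr
            exact hw x
    · exact mul_nonneg (Real.exp_pos _).le
        (mul_nonneg (hw x) ((Real.exp_pos _).le.trans h1))
  refine (Finset.sum_le_sum fun x _ => hterm x).trans ?_
  rw [← Finset.mul_sum, Finset.sum_add_distrib]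
  calc _ ≤ Real.exp (-(s * t)) * (d * Real.exp e + d * Real.exp e) := by
        gcongr
        · exact hp.trans (by gcongr)
        · exact hn.trans (by gcongr)
    _ = 2 * d * (Real.exp (-(s * t)) * Real.exp e) := by ring
    _ = _ := by rw [← Real.exp_add, hst]; congr 2; ring

end WeightedTail

/-! ### From the law of X to the weighted cube -/

section Law

variable {n : ℕ}

theorem coordOne_inter_allOnes (i : Fin n) (Λ : Finset (Fin n)) :
    coordOne i ∩ allOnes Λ = allOnes (insert i Λ) := by
  ext x; simp [coordOne, allOnes]

theorem onesMass_measureReal (μ : Measure (Fin n → Fin 2)) [IsFiniteMeasure μ]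
    (Λ : Finset (Fin n)) :
    onesMass (fun x => μ.real {x}) Λ = μ.real (allOnes Λ) := by
  classical
  have : allOnes Λ = ((Finset.univ.filter fun x : Fin n → Fin 2 => ∀ l ∈ Λ, x l = 1) :
      Set (Fin n → Fin 2)) := by ext x; simp [allOnes]
  rw [this, ← sum_measureReal_singleton, Finset.sum_filter]
  simp [onesMass, onesSum]

theorem toReal_cond_coordOne (μ : Measure (Fin n → Fin 2)) [IsFiniteMeasure μ]
    (Λ : Finset (Fin n)) (j : Fin n) :
    (μ[coordOne j | allOnes Λ]).toReal = condMass (fun x => μ.real {x}) Λ j := by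
  rw [cond_apply (MeasurableSet.of_discrete), Set.inter_comm, coordOne_inter_allOnes, condMass,
    onesMass_measureReal, onesMass_measureReal, ENNReal.toReal_mul, ENNReal.toReal_inv,
    div_eq_inv_mul]
  rfl

theorem OneSidedLinftyIndependent.sum_abs_le {μ : Measure (Fin n → Fin 2)} [IsFiniteMeasure μ]
    {D : ℝ} (h : OneSidedLinftyIndependent μ D) (Λ : Finset (Fin n)) (i : Fin n)
    (hi : onesMass (fun x => μ.real {x}) (insert i Λ) ≠ 0) :
    ∑ j, |condMass (fun x => μ.real {x}) (insert i Λ) j - condMass (fun x => μ.real {x}) Λ j| ≤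
      D := by
  refine le_trans ?_ (h Λ)
  rw [linftyOpNorm, Matrix.linfty_opNorm_def]
  have h1 : ∑ j, ‖influenceMatrix μ Λ i j‖₊ ≤
      Finset.univ.sup fun i => ∑ j, ‖influenceMatrix μ Λ i j‖₊ :=
    Finset.le_sup (f := fun i => ∑ j, ‖influenceMatrix μ Λ i j‖₊) (Finset.mem_univ i)
  refine le_trans (le_of_eq ?_) (NNReal.coe_le_coe.2 h1)
  rw [NNReal.coe_sum]
  refine Finset.sum_congr rfl fun j _ => ?_
  have hpos : 0 < μ (coordOne i ∩ allOnes Λ) := by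
    rw [coordOne_inter_allOnes, pos_iff_ne_zero]
    intro h0
    rw [onesMass_measureReal] at hi
    exact hi (by rw [Measure.real, h0, ENNReal.toReal_zero])
  rw [coe_nnnorm, Real.norm_eq_abs, influenceMatrix, Matrix.of_apply, if_pos hpos,
    coordOne_inter_allOnes, toReal_cond_coordOne, toReal_cond_coordOne]

theorem integral_matrixSum {Ω : Type*} [MeasurableSpace Ω] (P : Measure Ω)
    [IsProbabilityMeasure P] {d : ℕ} {X : Ω → Fin n → Fin 2} (hX : Measurable X)
    (B : Fin n → Matrix (Fin d) (Fin d) ℝ) :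
    ∫ ω, matrixSum X B ω ∂P = ∑ j, condMass (fun x => (P.map X).real {x}) ∅ j • B j := by
  have : IsProbabilityMeasure (P.map X) := Measure.isProbabilityMeasure_map hX.aemeasurable
  have h1 : ∫ ω, matrixSum X B ω ∂P =
      ∫ x, (∑ i, ((x i : ℕ) : ℝ) • B i) ∂(P.map X) := by
    rw [integral_map hX.aemeasurable]
    · rfl
    · exact StronglyMeasurable.of_discrete.aestronglyMeasurable
  have hone : onesMass (fun x => (P.map X).real {x}) ∅ = 1 := by
    rw [onesMass_measureReal]
    simp [allOnes]
  rw [h1, integral_fintype .of_finite]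
  simp only [Finset.smul_sum, smul_smul]
  rw [Finset.sum_comm]
  refine Finset.sum_congr rfl fun j _ => ?_
  rw [← Finset.sum_smul, condMass, hone, div_one, ← onesSum_indicator, onesSum_empty]
  simp only [natCast_coe_fin_two]

end Law

/-! ### The extended exponent and the conclusion -/

/-- The real exponent attached to the extended exponent of the matrix Bernstein bound. -/
theorem ofReal_inv_mul_min_bounds {c t σsq R : ℝ} (hc : 0 < c) (ht : 0 < t) (hσ : 0 ≤ σsq)
    (hR : 0 < R) :
    ∃ e : ℝ, 0 ≤ e ∧ c * e * R ≤ t ∧ c * e * σsq ≤ t ^ 2 ∧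
      (ENNReal.ofReal c)⁻¹ * min (ENNReal.ofReal (t ^ 2) / ENNReal.ofReal σsq)
        (ENNReal.ofReal t / ENNReal.ofReal R) = ENNReal.ofReal e := by
  -- For σ² = 0 the first quotient is ∞ in `ℝ≥0∞`, so the minimum is t / R.
  rcases hσ.eq_or_lt with rfl | hσ
  · refine ⟨c⁻¹ * (t / R), by positivity, ?_, ?_, ?_⟩
    · exact le_of_eq (by field_simp)
    · rw [mul_zero]; positivity
    · rw [ENNReal.ofReal_zero, ENNReal.div_zero (by simpa using ht.ne'), min_eq_right le_top,
        ← ENNReal.ofReal_inv_of_pos hc, ← ENNReal.ofReal_div_of_pos hR,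
        ← ENNReal.ofReal_mul (by positivity)]
  · refine ⟨c⁻¹ * min (t ^ 2 / σsq) (t / R), by positivity, ?_, ?_, ?_⟩
    · rw [mul_inv_cancel_left₀ hc.ne']
      exact (mul_le_mul_of_nonneg_right (min_le_right _ _) hR.le).trans_eq (by field_simp)
    · rw [mul_inv_cancel_left₀ hc.ne']
      exact (mul_le_mul_of_nonneg_right (min_le_left _ _) hσ.le).trans_eq (by field_simp)
    · rw [← ENNReal.ofReal_inv_of_pos hc, ← ENNReal.ofReal_div_of_pos hR,
        ← ENNReal.ofReal_div_of_pos hσ, ← ENNReal.ofReal_min, ← ENNReal.ofReal_mul (by positivity)]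

theorem Homogeneous.sum_eq {Ω : Type*} [MeasurableSpace Ω] {P : Measure Ω}
    [IsProbabilityMeasure P] {n k : ℕ} {X : Ω → Fin n → Fin 2} (hX : Measurable X)
    (h : Homogeneous P X k) (x : Fin n → Fin 2) (hx : (P.map X).real {x} ≠ 0) :
    ∑ i, (x i : ℕ) = k := by
  by_contra hne
  refine hx ?_
  rw [map_measureReal_apply hX (MeasurableSet.singleton x), measureReal_eq_zero_iff]
  refine measure_mono_null (fun ω hω => ?_) (ae_iff.1 h)
  rw [Set.mem_preimage, Set.mem_singleton_iff] at hω
  rwa [Set.mem_ofPred_eq, hω]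

/-- Almost every value of X is an atom, and there is just one atom, so Z is almost surely constant
and equals its mean. -/
theorem ae_norm_matrixSum_sub_integral_eq_zero {Ω : Type*} [MeasurableSpace Ω] {P : Measure Ω}
    [IsProbabilityMeasure P] {n d : ℕ} {X : Ω → Fin n → Fin 2} (hX : Measurable X)
    (A : Fin n → Matrix (Fin d) (Fin d) ℝ)
    (h : ∀ x y, (P.map X).real {x} ≠ 0 → (P.map X).real {y} ≠ 0 → x = y) :
    ∀ᵐ ω ∂P, ‖matrixSum X A ω - ∫ ω', matrixSum X A ω' ∂P‖ = 0 := by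
  have hae : ∀ᵐ ω ∂P, (P.map X).real {X ω} ≠ 0 := by
    have : IsProbabilityMeasure (P.map X) := Measure.isProbabilityMeasure_map hX.aemeasurable
    have h1 : ∀ᵐ x ∂(P.map X), (P.map X).real {x} ≠ 0 := by
      refine ae_iff_of_countable.2 fun x hx => ?_
      rwa [Ne, measureReal_eq_zero_iff]
    exact ae_of_ae_map hX.aemeasurable h1
  obtain ⟨ω₀, hω₀⟩ := hae.exists
  have hconst : ∀ᵐ ω ∂P, matrixSum X A ω = matrixSum X A ω₀ := by
    filter_upwards [hae] with ω hω
    rw [matrixSum, matrixSum, h _ _ hω hω₀]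
  filter_upwards [hconst] with ω hω
  rw [hω, integral_congr_ae hconst]
  simp

theorem theorem3p1 :
    ∃ C : ℝ, 0 < C ∧
      ∀ (Ω : Type*) [MeasurableSpace Ω] (P : Measure Ω) [IsProbabilityMeasure P]
        (n d k : ℕ) (X : Ω → Fin n → Fin 2) (A : Fin n → Matrix (Fin d) (Fin d) ℝ) (D : ℝ),
        Measurable X →
        (∀ i, (A i).IsSymm) →
        Homogeneous P X k →
        OneSidedLinftyIndependent (P.map X) D →
        ∀ (σsq R : ℝ),
          σsq = ‖∫ ω, matrixSum X (fun i => A i ^ 2) ω ∂P‖ →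
          R = ⨆ i, ‖A i‖ →
          ∀ t : ℝ, 0 < t →
            P {ω | t ≤ ‖matrixSum X A ω - ∫ ω', matrixSum X A ω' ∂P‖} ≤
              2 * (d : ℝ≥0∞) *
                EReal.exp (-(((ENNReal.ofReal (C * D ^ 2))⁻¹ *
                  min (ENNReal.ofReal (t ^ 2) / ENNReal.ofReal σsq)
                    (ENNReal.ofReal t / ENNReal.ofReal R) : ℝ≥0∞) : EReal)) := by
  refine ⟨28, by norm_num, ?_⟩
  intro Ω _ P _ n d k X A D hX hA hhom hind σsq R hσ hR t ht
  have : IsProbabilityMeasure (P.map X) := Measure.isProbabilityMeasure_map hX.aemeasurable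
  set w : (Fin n → Fin 2) → ℝ := fun x => (P.map X).real {x} with hwdef
  have hw (x : Fin n → Fin 2) : 0 ≤ w x := measureReal_nonneg
  have hk (x : Fin n → Fin 2) (hx : w x ≠ 0) : ∑ i, (x i : ℕ) = k := hhom.sum_eq hX x hx
  have hI := hind.sum_abs_le
  have hAh (i : Fin n) : (A i).IsHermitian := by
    rw [Matrix.IsHermitian, Matrix.conjTranspose_eq_transpose_of_trivial]; exact hA i
  -- Small D, including D = 0, is the point mass case: the left side vanishes whatever the exponent
  -- is.
  rcases lt_or_ge D (1 / 2) with hD | hD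
  · have hae := ae_norm_matrixSum_sub_integral_eq_zero hX A fun x y hx hy =>
      eq_of_condMass_sub_lt_half hw hk (fun Λ i hi => (hI Λ i hi).trans_lt hD) hx hy
    have h0 : P {ω | t ≤ ‖matrixSum X A ω - ∫ ω', matrixSum X A ω' ∂P‖} = 0 := by
      refine measure_mono_null (fun ω hω => ?_) (ae_iff.1 hae)
      exact (ht.trans_le hω).ne'
    rw [h0]
    exact zero_le
  have hRi (i : Fin n) : ‖A i‖ ≤ R := hR ▸ le_ciSup (Set.finite_range fun i => ‖A i‖).bddAbove i
  have hR0 : 0 ≤ R := hR ▸ Real.iSup_nonneg fun i => norm_nonneg _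
  -- If R = 0, which includes n = 0, every A_i is zero and the event is empty.
  rcases hR0.eq_or_lt with hR' | hRpos
  · have hA0 (i : Fin n) : A i = 0 := norm_le_zero_iff.1 (hR' ▸ hRi i)
    have h0 : {ω | t ≤ ‖matrixSum X A ω - ∫ ω', matrixSum X A ω' ∂P‖} = ∅ := by
      ext ω
      simp [matrixSum, hA0, ht]
    rw [h0, measure_empty]
    exact zero_le
  obtain ⟨e, he, heR, heσ, hexp⟩ := ofReal_inv_mul_min_bounds (c := 28 * D ^ 2) (by positivity) ht
    (hσ ▸ norm_nonneg _) hRpos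
  -- At Λ = ∅ nothing has been subtracted, so the remaining variance is the full 𝔼 ∑ X_i A_i².
  have hσ' : σsq = ‖condSquare w A ∅‖ := by
    rw [hσ, integral_matrixSum P hX]
    simp [condSquare, pow_two, hwdef]
  have hw1 : ∑ x, w x = 1 := by
    rw [hwdef, sum_measureReal_singleton]
    simp
  have key := sum_ite_norm_le hw hw1 hk hAh hRi hR0 hI hD ht he heR (hσ' ▸ heσ)
  have hEZ : ∫ ω, matrixSum X A ω ∂P = condMean w A ∅ := integral_matrixSum P hX A
  have hP : P {ω | t ≤ ‖matrixSum X A ω - ∫ ω', matrixSum X A ω' ∂P‖} =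
      ENNReal.ofReal (∑ x, (if t ≤ ‖(∑ i, ((x i : ℕ) : ℝ) • A i) - condMean w A ∅‖
        then w x else 0)) := by
    rw [hEZ, ← Finset.sum_filter, hwdef, sum_measureReal_singleton, ofReal_measureReal,
      Measure.map_apply hX MeasurableSet.of_discrete]
    simp [matrixSum, Set.preimage]
  rw [hP, hexp, EReal.coe_ennreal_ofReal, max_eq_left he, ← EReal.coe_neg, EReal.exp_coe]
  refine (ENNReal.ofReal_le_ofReal key).trans_eq ?_
  rw [ENNReal.ofReal_mul (by positivity), ENNReal.ofReal_mul (by norm_num)]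
  simp
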